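/- Let $G=(V,E)$ be a finite connected undirected graph and let $\mathbf c=(c_{zw})_{zw\in E}$ be nonnegative real numbers (conductances). For a configuration $\zeta\in\{0,1\}^V$ and $x,y\in V$ let $\zeta^{xy}$ be the configuration obtained from $\zeta$ by exchanging the values at $x$ and $y$, and for $f:\{0,1\}^V\to\mathbb R$ put $(\nabla_{xy}f)(\zeta)=f(\zeta^{xy})-f(\zeta)$. The symmetric exclusion process on $(G,\mathbf c)$ has generator $(\mathcal L^{\rm EX}f)(\zeta)=\sum_{zw\in E}c_{zw}(\nabla_{zw}f)(\zeta)$. For $\alpha\in[0,1]$ let $\nu_\alpha$ be the product Bernoulli measure on $\{0,1\}^V$ with $\nu_\alpha\{\zeta:\zeta(z)=1\}=\alpha$ for all $z\in V$, write $\nu_\alpha[g]=\int g\,d\nu_\alpha$, and let $$\mathcal E^{\rm EX}_{\nu_\alpha}(f)=\nu_\alpha\big[f\,(-\mathcal L^{\rm EX}f)\big]$$ be the exclusion Dirichlet energy. The effective resistance $R_{\rm eff}(x,y)\in[0,\infty]$ is defined by $$[R_{\rm eff}(x,y)]^{-1}=\inf\Big\{\sum_{zw\in E}c_{zw}[h(z)-h(w)]^2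 \;:\; h:V\to\mathbb R,\ h(x)=1,\ h(y)=0\Big\},$$ where sums over $E$ run over unordered edges, $\inf\emptyset=\infty$, $1/\infty=0$ and $1/0=\infty$ (so $R_{\rm eff}(x,x)=0$). Let $x,y\in V$ be joined by a (possibly trivial) path in $G$ all of whose edges have positive conductance; this holds for all $x,y\in V$ if every $c_{zw}$, $zw\in E$, is positive. Then $R_{\rm eff}(x,y)<\infty$, $$[R_{\rm eff}(x,y)]^{-1}=\inf\Big\{\frac{\sum_{zw\in E}c_{zw}[h(z)-h(w)]^2}{[h(x)-h(y)]^2} \;:\; h:V\to\mathbb R,\ h(x)\ne h(y)\Big\},$$ and for every $\alpha\in[0,1]$ and every $f:\{0,1\}^V\to\mathbb R$, $$\tfrac12\,\nu_\alpha\big[(\nabla_{xy}f)^2\big]\le R_{\rm eff}(x,y)\,\mathcal E^{\rm EX}_{\nu_\alpha}(f).$$ -/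

import Mathlib

open MeasureTheory ProbabilityTheory
open scoped ENNReal

noncomputable section

/-- Particle configurations, i.e. elements of `{0,1}^V`: `true` is an occupied vertex (`1`) and
`false` an empty vertex (`0`). -/
abbrev Config (V : Type*) := V → Bool

namespace Config

variable {V : Type*} [DecidableEq V]

/-- The configuration `ζ^{xy}`, in which the occupation values at `x` and `y` are exchanged. -/
def exchange (x y : V) (ζ : Config V) : Config V :=
  fun z => if z = x then ζ y else if z = y then ζ x else ζ z

theorem exchange_comm (x y : V) (ζ : Config V) : exchange x y ζ = exchange y x ζ := by
  funext z
  unfold exchange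
  split_ifs <;> simp_all

/-- The gradient `(∇_{xy} f)(ζ) = f(ζ^{xy}) - f(ζ)`. -/
def grad (x y : V) (f : Config V → ℝ) (ζ : Config V) : ℝ :=
  f (exchange x y ζ) - f ζ

/-- The gradient `∇_e f` along an unordered pair `e = xy`. -/
def edgeGrad (e : Sym2 V) (f : Config V → ℝ) (ζ : Config V) : ℝ :=
  Sym2.lift ⟨fun x y => grad x y f ζ, fun x y => by simp only [grad, exchange_comm x y]⟩ e

end Config

namespace WeightedGraph

variable {V : Type*} [Fintype V] [DecidableEq V] (G : SimpleGraph V) [DecidableRel G.Adj]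
  (c : Sym2 V → ℝ)

/-- The generator of the symmetric exclusion process,
`(L f)(ζ) = ∑_{xy ∈ E} c_{xy} (∇_{xy} f)(ζ)`. -/
def exclusionGenerator (f : Config V → ℝ) (ζ : Config V) : ℝ :=
  ∑ e ∈ G.edgeFinset, c e * Config.edgeGrad e f ζ

/-- The exclusion Dirichlet energy `ν[f (-L f)]` with respect to a measure `ν`. -/
def exclusionEnergy (ν : Measure (Config V)) (f : Config V → ℝ) : ℝ :=
  ∫ ζ, f ζ * (-exclusionGenerator G c f ζ) ∂ν

/-- The electric (random walk) energy `∑_{zw ∈ E} c_{zw} (h(z) - h(w))²`, a sum over unordered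
edges. -/
def electricEnergy (h : V → ℝ) : ℝ :=
  ∑ e ∈ G.edgeFinset, c e * Sym2.lift ⟨fun z w => (h z - h w) ^ 2, fun z w => by ring⟩ e

/-- The effective resistance: the reciprocal of the infimum of the energies of all `h` with
`h(x) = 1` and `h(y) = 0`. It is taken in `[0, ∞]`, so that it is `0` for `x = y` (where no such
`h` exists) and `∞` if the infimum is `0`. The energies are nonnegative for nonnegative `c`. -/
def effResistance (x y : V) : ℝ≥0∞ :=
  (⨅ h : {h : V → ℝ // h x = 1 ∧ h y = 0}, ENNReal.ofReal (electricEnergy G c h))⁻¹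

end WeightedGraph

/-- The subgraph of `G` formed by the edges of positive conductance. -/
def WeightedGraph.positiveSubgraph {V : Type*} (G : SimpleGraph V) (c : Sym2 V → ℝ) :
    SimpleGraph V :=
  SimpleGraph.fromEdgeSet {e | e ∈ G.edgeSet ∧ 0 < c e}

/-- The product Bernoulli measure `ν_α` on `{0,1}^V`: independent coordinates, each equal to `1`
with probability `α` and to `0` with probability `1 - α`. -/
def productBernoulli (V : Type*) [Fintype V] (α : unitInterval) : Measure (Config V) :=
  Measure.pi fun _ : V => bernoulliMeasure true false α

end

/-! ### Potentials of unit flows -/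

/-! Let `h` be the potential of the unit current from `x` to `y`, so that the effective resistance
is `h x - h y`, and let `Q e` be the mean of `(∇_e f)²`. The energy is half of `∑ c e * Q e`, so the
claim is `Q s(x, y) ≤ (h x - h y) * ∑ c e * Q e`.

This needs only nonnegativity of `Q` and the series law. Put `q z = Q s(x, z) / (h x - h z)`. On an
edge with `h w < h z < h x`, the series law with the potential drops as resistances reads `(h z - h
w) * (q w - q z) ≤ Q s(z, w)`. Weighting by `c` and summing, the left side is minus the pairing of
`h` with `q`, which is `q y - q x = Q s(x, y) / (h x - h y)` (`le_resistance_mul_sum`).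

The series law (`gradEnergy_series`) holds because occupation takes two values: if `x` and `w`
differ, `z` agrees with exactly one of them, and the exchange factors into two exchanges through
`z`. Cauchy–Schwarz and exchangeability of the weights finish. -/

section Potential

variable {V : Type*} (E : Finset (Sym2 V)) (c : Sym2 V → ℝ)

/-- The product `(h(z) - h(w)) (g(z) - g(w))` of the increments of `h` and `g` along an
unordered pair. -/
def edgeProduct (h g : V → ℝ) (e : Sym2 V) : ℝ :=
  Sym2.lift ⟨fun z w => (h z - h w) * (g z - g w), fun z w => by ring⟩ e

@[simp]
theorem edgeProduct_mk (h g : V → ℝ) (z w : V) :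
    edgeProduct h g s(z, w) = (h z - h w) * (g z - g w) := rfl

/-- The bilinear form polarizing the electric energy. -/
noncomputable def electricForm : (V → ℝ) →ₗ[ℝ] (V → ℝ) →ₗ[ℝ] ℝ :=
  LinearMap.mk₂ ℝ (fun h g => ∑ e ∈ E, c e * edgeProduct h g e)
    (fun h h' g => by
      rw [← Finset.sum_add_distrib]
      refine Finset.sum_congr rfl fun e _ => ?_
      induction e with | _ z w => simp only [edgeProduct_mk, Pi.add_apply]; ring)
    (fun a h g => by
      rw [smul_eq_mul, Finset.mul_sum]
      refine Finset.sum_congr rfl fun e _ => ?_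
      induction e with | _ z w => simp only [edgeProduct_mk, Pi.smul_apply, smul_eq_mul]; ring)
    (fun h g g' => by
      rw [← Finset.sum_add_distrib]
      refine Finset.sum_congr rfl fun e _ => ?_
      induction e with | _ z w => simp only [edgeProduct_mk, Pi.add_apply]; ring)
    (fun a h g => by
      rw [smul_eq_mul, Finset.mul_sum]
      refine Finset.sum_congr rfl fun e _ => ?_
      induction e with | _ z w => simp only [edgeProduct_mk, Pi.smul_apply, smul_eq_mul]; ring)

theorem electricForm_apply (h g : V → ℝ) :
    electricForm E c h g = ∑ e ∈ E, c e * edgeProduct h g e := rfl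

theorem electricForm_comm (h g : V → ℝ) : electricForm E c h g = electricForm E c g h := by
  simp only [electricForm_apply]
  refine Finset.sum_congr rfl fun e _ => ?_
  induction e with | _ z w => simp only [edgeProduct_mk]; ring

variable {E c}

theorem edgeProduct_self_nonneg (h : V → ℝ) (e : Sym2 V) : 0 ≤ edgeProduct h h e := by
  induction e with | _ z w => exact mul_self_nonneg _

theorem electricForm_self_nonneg (hc : ∀ e ∈ E, 0 ≤ c e) (h : V → ℝ) :
    0 ≤ electricForm E c h h :=
  Finset.sum_nonneg fun e he => mul_nonneg (hc e he) (edgeProduct_self_nonneg h e)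

theorem eq_of_electricForm_self_eq_zero (hc : ∀ e ∈ E, 0 ≤ c e) {x y : V}
    (hxy : (SimpleGraph.fromEdgeSet {e | e ∈ E ∧ 0 < c e}).Reachable x y) {h : V → ℝ}
    (hh : electricForm E c h h = 0) : h x = h y := by
  rw [electricForm_apply, Finset.sum_eq_zero_iff_of_nonneg
    fun e he => mul_nonneg (hc e he) (edgeProduct_self_nonneg h e)] at hh
  obtain ⟨p⟩ := hxy
  induction p with
  | nil => rfl
  | cons hadj _ ih =>
    rw [SimpleGraph.fromEdgeSet_adj] at hadj
    have := (mul_eq_zero.1 (hh _ hadj.1.1)).resolve_left hadj.1.2.ne'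
    rw [← ih]
    exact sub_eq_zero.1 (mul_self_eq_zero.1 this)

/-- Between two vertices joined by edges of positive conductance there is a unit electric
current; `h` is its potential. -/
theorem exists_unit_potential [Finite V] (hc : ∀ e ∈ E, 0 ≤ c e) {x y : V}
    (hxy : (SimpleGraph.fromEdgeSet {e | e ∈ E ∧ 0 < c e}).Reachable x y) :
    ∃ h : V → ℝ, ∀ g : V → ℝ, electricForm E c h g = g x - g y := by
  let K : (V → ℝ) →ₗ[ℝ] ℝ := (LinearMap.proj x : (V → ℝ) →ₗ[ℝ] ℝ) - LinearMap.proj y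
  have hK : K ∈ Submodule.span ℝ (Set.range (electricForm E c)) := by
    -- A `g` orthogonal to everything has zero energy, hence `g x = g y`.
    apply FiniteDimensional.mem_span_of_iInf_ker_le_ker
    intro g hg
    simp only [Submodule.mem_iInf, LinearMap.mem_ker] at hg
    simpa [K, sub_eq_zero] using eq_of_electricForm_self_eq_zero hc hxy (hg g)
  rw [← LinearMap.coe_range, Submodule.span_eq] at hK
  obtain ⟨h, hh⟩ := hK
  exact ⟨h, fun g => by rw [hh]; rfl⟩

theorem sq_sub_le_mul_electricForm (hc : ∀ e ∈ E, 0 ≤ c e) {x y : V} {h : V → ℝ}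
    (hh : ∀ g : V → ℝ, electricForm E c h g = g x - g y) (g : V → ℝ) :
    (g x - g y) ^ 2 ≤ (h x - h y) * electricForm E c g g := by
  have key (t : ℝ) : 0 ≤ (h x - h y) * (t * t) + -2 * (g x - g y) * t + electricForm E c g g := by
    have := electricForm_self_nonneg hc (t • h - g)
    simp only [map_sub, map_smul, LinearMap.sub_apply, LinearMap.smul_apply, smul_eq_mul,
      electricForm_comm E c g h, hh] at this
    linarith
  have := discrim_le_zero key
  rw [discrim] at this
  linarith

theorem unit_potential_lt (hc : ∀ e ∈ E, 0 ≤ c e) {x y : V} (hne : x ≠ y) {h : V → ℝ}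
    (hh : ∀ g : V → ℝ, electricForm E c h g = g x - g y) : h y < h x := by
  classical
  have h1 := sq_sub_le_mul_electricForm hc hh (Pi.single x 1)
  rw [Pi.single_eq_same, Pi.single_eq_of_ne' hne] at h1
  have h2 := electricForm_self_nonneg hc (Pi.single x 1)
  by_contra! h3
  nlinarith

/-- Current enters the superlevel set `{h ≥ h(x)}` only at `x`. -/
theorem eq_or_lt_or_le_of_lt (hc : ∀ e ∈ E, 0 ≤ c e) {x y : V} (hne : x ≠ y) {h : V → ℝ}
    (hh : ∀ g : V → ℝ, electricForm E c h g = g x - g y) {z w : V} (he : s(z, w) ∈ E)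
    (hcp : 0 < c s(z, w)) (hzw : h w < h z) : z = x ∨ h z < h x ∨ h x ≤ h w := by
  classical
  have hyx := unit_potential_lt hc hne hh
  -- Excluding `x` makes `g x = g y = 0`, so the pairing of `h` with `g` vanishes although all its
  -- terms are nonnegative.
  let g : V → ℝ := fun v => if h x ≤ h v ∧ v ≠ x then 1 else 0
  have hterm : ∀ e ∈ E, 0 ≤ c e * edgeProduct h g e := by
    intro e he
    refine mul_nonneg (hc e he) ?_
    induction e with
    | _ a b =>
      have aux (a b : V) (hab : h b < h a) : 0 ≤ g a - g b := by
        simp only [g]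
        split_ifs with h1 h2 h2
        · simp
        · simp
        · refine absurd ⟨h2.1.trans hab.le, ?_⟩ h1
          rintro rfl
          linarith [h2.1]
        · simp
      rw [edgeProduct_mk]
      rcases lt_trichotomy (h a) (h b) with hab | hab | hab
      · nlinarith [aux b a hab]
      · simp [hab]
      · nlinarith [aux a b hab]
  have hsum : ∑ e ∈ E, c e * edgeProduct h g e = 0 := by
    rw [← electricForm_apply, hh]
    simp [g, hyx]
  rw [Finset.sum_eq_zero_iff_of_nonneg hterm] at hsum
  have h0 := (mul_eq_zero.1 (hsum _ he)).resolve_left hcp.ne'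
  rw [edgeProduct_mk] at h0
  have h1 := (mul_eq_zero.1 h0).resolve_left (sub_pos.2 hzw).ne'
  by_contra! hcon
  simp [g, hcon.1, hcon.2.1, hcon.2.2.not_ge] at h1

/-- An edge function obeying the series law for resistors obeys the inequality for the effective
resistance of the whole network. -/
theorem le_resistance_mul_sum (hc : ∀ e ∈ E, 0 ≤ c e) {x y : V} (hne : x ≠ y) {h : V → ℝ}
    (hh : ∀ g : V → ℝ, electricForm E c h g = g x - g y) {Q : Sym2 V → ℝ} (hQ : ∀ e, 0 ≤ Q e)
    (hseries : ∀ u v w : V, u ≠ v → v ≠ w → u ≠ w → ∀ r s : ℝ, 0 < r → 0 < s →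
      Q s(u, w) ≤ (r + s) * (Q s(u, v) / r + Q s(v, w) / s)) :
    Q s(x, y) ≤ (h x - h y) * ∑ e ∈ E, c e * Q e := by
  have hyx := unit_potential_lt hc hne hh
  -- The value 0 on `{h ≥ h x}` gives `q x = 0` and makes edges inside that set harmless.
  let q : V → ℝ := fun z => if h z < h x then Q s(x, z) / (h x - h z) else 0
  have key (z w : V) (he : s(z, w) ∈ E) (hcp : 0 < c s(z, w)) (hzw : h w < h z) :
      (h z - h w) * (q w - q z) ≤ Q s(z, w) := by
    have hd : 0 < h z - h w := sub_pos.2 hzw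
    rcases eq_or_lt_or_le_of_lt hc hne hh he hcp hzw with rfl | hz | hw
    · simp only [q, hzw, if_true, lt_irrefl, if_false, sub_zero]
      rw [mul_div_cancel₀ _ hd.ne']
    · have hw : h w < h x := hzw.trans hz
      have hr : 0 < h x - h z := sub_pos.2 hz
      have hs := hseries x z w (by rintro rfl; exact lt_irrefl _ hz)
        (by rintro rfl; exact lt_irrefl _ hzw) (by rintro rfl; exact lt_irrefl _ hw) _ _ hr hd
      rw [sub_add_sub_cancel] at hs
      have hq : q w - q z ≤ Q s(z, w) / (h z - h w) := by
        simp only [q, hw, hz, if_true]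
        rw [sub_le_iff_le_add', div_le_iff₀' (sub_pos.2 hw)]
        exact hs
      rwa [le_div_iff₀' hd] at hq
    · simp [q, hw.not_gt, (hw.trans hzw.le).not_gt, hQ]
  have hq := hh q
  have hqx : q x = 0 := by simp [q]
  have hqy : q y = Q s(x, y) / (h x - h y) := by simp [q, hyx]
  rw [hqx, hqy, electricForm_apply] at hq
  rw [← div_le_iff₀' (sub_pos.2 hyx), ← neg_le_neg_iff, ← zero_sub (_ / _), ← hq,
    ← Finset.sum_neg_distrib]
  refine Finset.sum_le_sum fun e he => ?_
  rcases (hc e he).eq_or_lt with h0 | hcp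
  · simp [← h0]
  · rw [← mul_neg]
    refine mul_le_mul_of_nonneg_left ?_ hcp.le
    induction e with
    | _ z w =>
      rw [edgeProduct_mk]
      rcases lt_trichotomy (h z) (h w) with hab | hab | hab
      · rw [Sym2.eq_swap] at he hcp ⊢
        linarith [key w z he hcp hab]
      · simp [hab, hQ]
      · linarith [key z w he hcp hab]

end Potential

/-! ### Exchangeable weights on configurations -/

namespace Config

section Exchange

variable {V : Type*} [DecidableEq V]

theorem exchange_eq_comp_swap (x y : V) (ζ : Config V) :
    exchange x y ζ = ζ ∘ Equiv.swap x y := by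
  funext z
  simp only [exchange, Function.comp_apply, Equiv.swap_apply_def]
  split_ifs <;> rfl

@[simp]
theorem exchange_exchange (x y : V) (ζ : Config V) : exchange x y (exchange x y ζ) = ζ := by
  funext z
  simp [exchange_eq_comp_swap]

theorem exchange_eq_self {x y : V} {ζ : Config V} (h : ζ x = ζ y) : exchange x y ζ = ζ := by
  funext z
  unfold exchange
  split_ifs <;> simp_all

theorem grad_eq_zero (f : Config V → ℝ) {x y : V} {ζ : Config V} (h : ζ x = ζ y) :
    grad x y f ζ = 0 := by
  rw [grad, exchange_eq_self h, sub_self]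

@[simp]
theorem edgeGrad_mk (x y : V) (f : Config V → ℝ) (ζ : Config V) :
    edgeGrad s(x, y) f ζ = grad x y f ζ := rfl

/-- The two exchanges compose to a 3-cycle, which acts as the transposition of `x` and `w` because
`z` and `w` carry equal values. -/
theorem grad_eq_add_left {x z w : V} (hxz : x ≠ z) (hzw : z ≠ w) (hxw : x ≠ w)
    (f : Config V → ℝ) {ζ : Config V} (h : ζ z = ζ w) :
    grad x w f ζ = grad x z f ζ + grad z w f (exchange x z ζ) := by
  have : exchange z w (exchange x z ζ) = exchange x w ζ := by
    funext v
    unfold exchange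
    split_ifs <;> simp_all
  rw [grad, grad, grad, this]
  ring

theorem sq_add_le_series (a b : ℝ) {r s : ℝ} (hr : 0 < r) (hs : 0 < s) :
    (a + b) ^ 2 ≤ (r + s) * (a ^ 2 / r + b ^ 2 / s) := by
  have : (r + s) * (a ^ 2 / r + b ^ 2 / s) - (a + b) ^ 2 = (a * s - b * r) ^ 2 / (r * s) := by
    field_simp
    ring
  have : 0 ≤ (a * s - b * r) ^ 2 / (r * s) := by positivity
  linarith

/-- On a half of the configurations that are changed by exchanging `x` and `w`, the exchange is
made by moving through `z` along `x`, `z`, `w`; the other half moves through `w`, `z`, `x`. -/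
theorem grad_sq_le_series {x z w : V} (hxz : x ≠ z) (hzw : z ≠ w) (hxw : x ≠ w)
    (f : Config V → ℝ) {r s : ℝ} (hr : 0 < r) (hs : 0 < s) (ζ : Config V) :
    grad x w f ζ ^ 2 ≤ (r + s) *
      (((if ζ z = ζ w then grad x z f ζ ^ 2 else 0) +
          (if ζ x = ζ z then grad x z f (exchange z w ζ) ^ 2 else 0)) / r +
        ((if ζ x = ζ z then grad z w f ζ ^ 2 else 0) +
          (if ζ z = ζ w then grad z w f (exchange x z ζ) ^ 2 else 0)) / s) := by
  by_cases h1 : ζ x = ζ w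
  · rw [grad_eq_zero f h1]
    have : 0 ≤ r + s := by positivity
    simp only [ne_eq, OfNat.ofNat_ne_zero, not_false_eq_true, zero_pow]
    refine mul_nonneg this (add_nonneg (div_nonneg ?_ hr.le) (div_nonneg ?_ hs.le)) <;>
      split_ifs <;> positivity
  by_cases h2 : ζ z = ζ w
  · have h3 : ζ x ≠ ζ z := fun h => h1 (h.trans h2)
    simp only [if_pos h2, if_neg h3, add_zero, zero_add]
    rw [grad_eq_add_left hxz hzw hxw f h2]
    exact sq_add_le_series _ _ hr hs
  · have h3 : ζ x = ζ z := by
      revert h1 h2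
      cases ζ x <;> cases ζ z <;> cases ζ w <;> simp
    have h4 : grad x w f ζ = grad x z f (exchange z w ζ) + grad z w f ζ := by
      have := grad_eq_add_left hzw.symm hxz.symm hxw.symm f h3.symm
      simp only [grad, exchange_comm w] at this ⊢
      rw [this, exchange_comm x z]
      ring
    simp only [if_neg h2, if_pos h3, add_zero, zero_add]
    rw [h4]
    exact sq_add_le_series _ _ hr hs

variable [Fintype V]

/-- The weights `μ` are invariant under exchanges. -/
def Exchangeable (μ : Config V → ℝ) : Prop :=
  ∀ (x y : V) (ζ : Config V), μ (exchange x y ζ) = μ ζ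

/-- The sum `∑ μ(ζ) (∇_e f)(ζ)²`. -/
noncomputable def gradEnergy (μ : Config V → ℝ) (f : Config V → ℝ) (e : Sym2 V) : ℝ :=
  ∑ ζ, μ ζ * edgeGrad e f ζ ^ 2

theorem gradEnergy_nonneg {μ : Config V → ℝ} (hμ : 0 ≤ μ) (f : Config V → ℝ) (e : Sym2 V) :
    0 ≤ gradEnergy μ f e :=
  Finset.sum_nonneg fun ζ _ => mul_nonneg (hμ ζ) (sq_nonneg _)

theorem sum_exchange (x y : V) (F : Config V → ℝ) : ∑ ζ, F (exchange x y ζ) = ∑ ζ, F ζ :=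
  Equiv.sum_comp (Function.Involutive.toPerm _ (exchange_exchange x y)) F

theorem Exchangeable.sum_exchange {μ : Config V → ℝ} (hμ : Exchangeable μ) (x y : V)
    (F : Config V → ℝ) : ∑ ζ, μ ζ * F (exchange x y ζ) = ∑ ζ, μ ζ * F ζ := by
  rw [← Config.sum_exchange x y fun ζ => μ ζ * F ζ]
  simp only [hμ x y]

/-- With `f'` for `f` after the exchange, `f (f - f') = (f' - f)² / 2 - (f'² - f²) / 2`, and the
last term has zero sum by invariance. -/
theorem Exchangeable.sum_mul_neg_edgeGrad {μ : Config V → ℝ} (hμ : Exchangeable μ)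
    (f : Config V → ℝ) (e : Sym2 V) :
    ∑ ζ, μ ζ * (f ζ * -edgeGrad e f ζ) = 1 / 2 * gradEnergy μ f e := by
  induction e with
  | _ x y =>
    have h := hμ.sum_exchange x y fun ζ => f ζ ^ 2
    rw [← sub_eq_zero, ← Finset.sum_sub_distrib] at h
    rw [← sub_eq_zero, gradEnergy, Finset.mul_sum, ← Finset.sum_sub_distrib]
    rw [← mul_zero (-(1 / 2) : ℝ), ← h, Finset.mul_sum]
    refine Finset.sum_congr rfl fun ζ _ => ?_
    rw [edgeGrad_mk, grad]
    ring

theorem Exchangeable.gradEnergy_series {μ : Config V → ℝ} (hμ : Exchangeable μ) (hμ0 : 0 ≤ μ)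
    (f : Config V → ℝ) {x z w : V} (hxz : x ≠ z) (hzw : z ≠ w) (hxw : x ≠ w)
    {r s : ℝ} (hr : 0 < r) (hs : 0 < s) :
    gradEnergy μ f s(x, w) ≤
      (r + s) * (gradEnergy μ f s(x, z) / r + gradEnergy μ f s(z, w) / s) := by
  -- Exchanging `b` and `c` turns the second condition into `ζ a = ζ c`. When `ζ a ≠ ζ b`, exactly
  -- one of `ζ a`, `ζ b` equals `ζ c`, so each contributing configuration is counted once and no
  -- constant is lost.
  have split (a b c : V) (hab : a ≠ b) (hbc : b ≠ c) (hac : a ≠ c) :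
      ∑ ζ, μ ζ * ((if ζ b = ζ c then grad a b f ζ ^ 2 else 0) +
        (if ζ a = ζ b then grad a b f (exchange b c ζ) ^ 2 else 0)) =
      gradEnergy μ f s(a, b) := by
    simp only [mul_add, Finset.sum_add_distrib]
    have h := hμ.sum_exchange b c fun ζ => if ζ a = ζ c then grad a b f ζ ^ 2 else 0
    have hb (ζ : Config V) : exchange b c ζ c = ζ b := by simp [exchange, hbc.symm]
    have ha (ζ : Config V) : exchange b c ζ a = ζ a := by simp [exchange, hab, hac]
    simp only [ha, hb] at h
    rw [h, ← Finset.sum_add_distrib]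
    refine Finset.sum_congr rfl fun ζ _ => ?_
    rw [← mul_add, edgeGrad_mk]
    by_cases h0 : ζ a = ζ b
    · simp [grad_eq_zero f h0]
    · congr 1
      revert h0
      cases ζ a <;> cases ζ b <;> cases ζ c <;> simp
  have hz := split w z x hzw.symm hxz.symm hxw.symm
  simp only [Sym2.eq_swap (a := w) (b := z)] at hz
  rw [← split x z w hxz hzw hxw, ← hz, gradEnergy, Finset.sum_div, Finset.sum_div,
    ← Finset.sum_add_distrib, Finset.mul_sum]
  refine Finset.sum_le_sum fun ζ _ => ?_
  refine (mul_le_mul_of_nonneg_left (grad_sq_le_series hxz hzw hxw f hr hs ζ) (hμ0 ζ)).trans_eq ?_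
  simp only [grad, exchange_comm w z, exchange_comm z x, eq_comm (a := ζ z) (b := ζ x),
    eq_comm (a := ζ w) (b := ζ z)]
  ring

end Exchange

end Config

/-! ### Bernoulli weights and the exclusion energy -/

theorem exchangeable_productBernoulli {V : Type*} [Fintype V] [DecidableEq V]
    (α : unitInterval) :
    Config.Exchangeable fun ζ : Config V => (productBernoulli V α).real {ζ} := by
  intro x y ζ
  simp only [productBernoulli, measureReal_def, Measure.pi_singleton]
  rw [Config.exchange_eq_comp_swap]
  congr 1
  exact Equiv.prod_comp (Equiv.swap x y) fun v => bernoulliMeasure true false α {ζ v}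

theorem integral_productBernoulli {V : Type*} [Fintype V] [DecidableEq V] (α : unitInterval)
    (F : Config V → ℝ) :
    ∫ ζ, F ζ ∂(productBernoulli V α) = ∑ ζ, (productBernoulli V α).real {ζ} * F ζ := by
  have : IsProbabilityMeasure (productBernoulli V α) := by
    unfold productBernoulli
    infer_instance
  exact integral_fintype (Integrable.of_finite)

namespace WeightedGraph

theorem exclusionEnergy_productBernoulli {V : Type*} [Fintype V] [DecidableEq V]
    (G : SimpleGraph V) [DecidableRel G.Adj] (c : Sym2 V → ℝ) (α : unitInterval)
    (f : Config V → ℝ) :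
    exclusionEnergy G c (productBernoulli V α) f = 1 / 2 * ∑ e ∈ G.edgeFinset, c e *
      Config.gradEnergy (fun ζ => (productBernoulli V α).real {ζ}) f e := by
  rw [exclusionEnergy, integral_productBernoulli, Finset.mul_sum]
  simp only [exclusionGenerator, ← Finset.sum_neg_distrib, Finset.mul_sum]
  rw [Finset.sum_comm]
  refine Finset.sum_congr rfl fun e _ => ?_
  rw [mul_left_comm, ← (exchangeable_productBernoulli α).sum_mul_neg_edgeGrad, Finset.mul_sum]
  exact Finset.sum_congr rfl fun ζ _ => by ring

/-! ### Effective resistance as a potential difference -/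

section Resistance

variable {V : Type*} [Fintype V] {G : SimpleGraph V} [DecidableRel G.Adj]
  {c : Sym2 V → ℝ}

theorem electricEnergy_eq_electricForm (h : V → ℝ) :
    electricEnergy G c h = electricForm G.edgeFinset c h h := by
  refine Finset.sum_congr rfl fun e _ => ?_
  induction e with | _ z w => simp [sq]

/-- Normalizing a function with `h(x) ≠ h(y)` so that it is `1` at `x` and `0` at `y`. -/
theorem electricEnergy_normalize {x y : V} {h : V → ℝ} :
    electricEnergy G c (fun v => (h v - h y) / (h x - h y)) =
      electricEnergy G c h / (h x - h y) ^ 2 := by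
  rw [electricEnergy, electricEnergy, Finset.sum_div]
  refine Finset.sum_congr rfl fun e _ => ?_
  induction e with
  | _ z w =>
    simp only [Sym2.lift_mk]
    rw [← sub_div, div_pow, sub_sub_sub_cancel_right, mul_div_assoc]

theorem iInf_electricEnergy_eq (x y : V) :
    ⨅ h : {h : V → ℝ // h x = 1 ∧ h y = 0}, ENNReal.ofReal (electricEnergy G c h) =
      ⨅ h : {h : V → ℝ // h x ≠ h y},
        ENNReal.ofReal (electricEnergy G c h / (h.1 x - h.1 y) ^ 2) := by
  refine le_antisymm (le_iInf fun ⟨h, hh⟩ => ?_) (le_iInf fun ⟨h, hx, hy⟩ => ?_)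
  · refine (iInf_le _ ⟨fun v => (h v - h y) / (h x - h y),
      div_self (sub_ne_zero.2 hh), by simp⟩).trans_eq ?_
    rw [electricEnergy_normalize]
  · refine (iInf_le _ ⟨h, by simp [hx, hy]⟩).trans_eq ?_
    simp [hx, hy]

theorem effResistance_self (x : V) : effResistance G c x x = 0 := by
  have : IsEmpty {h : V → ℝ // h x = 1 ∧ h x = 0} :=
    ⟨fun ⟨h, h1, h0⟩ => one_ne_zero (h1.symm.trans h0)⟩
  rw [effResistance, iInf_of_empty, ENNReal.inv_top]

/-- The potential `h` has energy `h x - h y`, so its quotient is `1 / (h x - h y)`; Cauchy–Schwarz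
shows that no other function does better. -/
theorem effResistance_eq_of_unit_potential (hc : ∀ e ∈ G.edgeFinset, 0 ≤ c e) {x y : V}
    (hne : x ≠ y) {h : V → ℝ}
    (hh : ∀ g : V → ℝ, electricForm G.edgeFinset c h g = g x - g y) :
    effResistance G c x y = ENNReal.ofReal (h x - h y) := by
  have hR : 0 < h x - h y := sub_pos.2 (unit_potential_lt hc hne hh)
  rw [effResistance, iInf_electricEnergy_eq, ← inv_inv (ENNReal.ofReal (h x - h y)),
    ← ENNReal.ofReal_inv_of_pos hR]
  congr 1
  refine le_antisymm ((iInf_le _ ⟨h, sub_ne_zero.1 hR.ne'⟩).trans_eq ?_)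
    (le_iInf fun ⟨g, hg⟩ => ENNReal.ofReal_le_ofReal ?_)
  · rw [electricEnergy_eq_electricForm, hh]
    congr 1
    field_simp
  · have hg' : 0 < (g x - g y) ^ 2 := by
      have := sub_ne_zero.2 hg
      positivity
    rw [electricEnergy_eq_electricForm, le_div_iff₀ hg', inv_mul_le_iff₀ hR]
    exact sq_sub_le_mul_electricForm hc hh g

end Resistance

end WeightedGraph

theorem theorem1p1 {V : Type*} [Fintype V] [DecidableEq V]
    (G : SimpleGraph V) [DecidableRel G.Adj] (hG : G.Connected)
    (c : Sym2 V → ℝ) (hc : ∀ e ∈ G.edgeSet, 0 ≤ c e)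
    (x y : V) (hxy : (WeightedGraph.positiveSubgraph G c).Reachable x y) :
    WeightedGraph.effResistance G c x y ≠ ⊤ ∧
    (WeightedGraph.effResistance G c x y)⁻¹ =
      ⨅ h : {h : V → ℝ // h x ≠ h y},
        ENNReal.ofReal (WeightedGraph.electricEnergy G c h / (h.1 x - h.1 y) ^ 2) ∧
    ∀ (α : unitInterval) (f : Config V → ℝ),
      (1 / 2 : ℝ) * ∫ ζ, (Config.grad x y f ζ) ^ 2 ∂(productBernoulli V α) ≤
        (WeightedGraph.effResistance G c x y).toReal *
          WeightedGraph.exclusionEnergy G c (productBernoulli V α) f := by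
  have hinv : (WeightedGraph.effResistance G c x y)⁻¹ = _ :=
    (inv_inv _).trans (WeightedGraph.iInf_electricEnergy_eq x y)
  rcases eq_or_ne x y with rfl | hne
  · refine ⟨?_, hinv, fun α f => ?_⟩ <;> rw [WeightedGraph.effResistance_self]
    · exact ENNReal.zero_ne_top
    · simp [Config.grad_eq_zero f rfl]
  have hc' : ∀ e ∈ G.edgeFinset, 0 ≤ c e := fun e he => hc e (SimpleGraph.mem_edgeFinset.1 he)
  obtain ⟨h, hh⟩ := exists_unit_potential hc'
    (by simpa only [SimpleGraph.mem_edgeFinset, WeightedGraph.positiveSubgraph] using hxy)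
  have hR := WeightedGraph.effResistance_eq_of_unit_potential hc' hne hh
  refine ⟨hR ▸ ENNReal.ofReal_ne_top, hinv, fun α f => ?_⟩
  rw [hR, ENNReal.toReal_ofReal (sub_pos.2 (unit_potential_lt hc' hne hh)).le,
    WeightedGraph.exclusionEnergy_productBernoulli, integral_productBernoulli, mul_left_comm]
  have hμ := exchangeable_productBernoulli (V := V) α
  have hμ0 : (0 : Config V → ℝ) ≤ fun ζ => (productBernoulli V α).real {ζ} :=
    fun ζ => measureReal_nonneg
  refine mul_le_mul_of_nonneg_left ?_ (by norm_num)
  exact le_resistance_mul_sum hc' hne hh (Config.gradEnergy_nonneg hμ0 f)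
    fun u v w huv hvw huw r s hr hs => hμ.gradEnergy_series hμ0 f huv hvw huw hr hs
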